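/- Let $1<p<\infty$, $p'=p/(p-1)$ and $\ell>p-1$. There is $\lambda(p,\ell)>0$, depending only on $p$ and $\ell$, such that for all $\lambda\ge\lambda(p,\ell)$, all $N$ and all $K_p>0$ there is a constant $C=C(N,p,K_p,\ell,\lambda)>0$ for which the following holds. Let $\Omega\subset\mathbb R^N$ be open and let $A_p:\Omega\times[0,\infty)\times\mathbb R^N\to\mathbb R^N$ be a Carathéodory function that is weakly $p$-coercive with constant $K_p$, that is, $$A_p(x,s,\eta)\cdot\eta\ \ge\ K_p\,|A_p(x,s,\eta)|^{p'}\qquad\text{for all }(x,s,\eta)\in\Omega\times[0,\infty)\times\mathbb R^N,$$ and write $\mathcal A_pu=\operatorname{div}\big(A_p(x,u,\nabla u)\big)$. Let $f\in L^1_{loc}(\Omega)$, $f\ge0$, and let $u\in W^{1,p}_{loc}(\Omega)$, $u\ge 0$, be a weak solution in $\Omega$ of $$-\mathcal A_pu\ge f\qquad\text{or of}\qquad -\mathcal A_pu+f\le0 .$$ Here $u$ is a weak solution of $-\mathcal A_pu\ge g$ (respectively $\le g$) if $A_p(x,u,\nabla u)\in L^{p'}_{loc}(\Omega)$ and $\int_\Omega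 A_p(x,u,\nabla u)\cdot\nabla\phi\ge\int_\Omega g\phi$ (respectively $\le$) for every nonnegative $\phi\in W^{1,\infty}(\Omega)$ with compact support in $\Omega$; and $-\mathcal A_pu+f\le 0$ means $-\mathcal A_pu\le -f$. Let $\xi\in C_c^\infty(\Omega)$ take values in $[0,1]$, and put $\varphi=\xi^\lambda$ and $S_\xi=\operatorname{supp}|\nabla\xi|$. Then $$\int_\Omega f\varphi\ \le\ C\,|S_\xi|\,\max_\Omega|\nabla\xi|^p\left(\frac1{|S_\xi|}\int_{S_\xi}u^\ell\right)^{\frac{p-1}{\ell}},$$ where the right-hand side is $+\infty$ if $\int_{S_\xi}u^\ell=\infty$, and is $0$ if $|S_\xi|=0$. -/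

import Mathlib

open MeasureTheory TopologicalSpace Set
open scoped ENNReal NNReal Gradient Distributions

namespace QuasilinearEstimate

/-- `g ∈ L^q_loc(Ω)`: `g` is in `L^q` of every compact subset of `Ω`. -/
def MemLpLoc {N : ℕ} {F : Type*} [NormedAddCommGroup F]
    (Ω : Opens (EuclideanSpace ℝ (Fin N))) (q : ℝ≥0∞)
    (g : EuclideanSpace ℝ (Fin N) → F) : Prop :=
  ∀ K : Set (EuclideanSpace ℝ (Fin N)), IsCompact K → K ⊆ (Ω : Set _) →
    MemLp g q (volume.restrict K)

/-- `G` is the weak (distributional) gradient of `u` in `Ω`, both being locally integrable. -/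
def HasWeakGradient {N : ℕ} (Ω : Opens (EuclideanSpace ℝ (Fin N)))
    (u : EuclideanSpace ℝ (Fin N) → ℝ)
    (G : EuclideanSpace ℝ (Fin N) → EuclideanSpace ℝ (Fin N)) : Prop :=
  MemLpLoc Ω 1 u ∧ MemLpLoc Ω 1 G ∧
    ∀ ψ : 𝓓(Ω, ℝ), ∫ x in (Ω : Set _), u x • ∇ ψ x = - ∫ x in (Ω : Set _), ψ x • G x

/-- `u ∈ W^{1,p}_loc(Ω)` with weak gradient `G`. -/
def MemW1pLoc {N : ℕ} (Ω : Opens (EuclideanSpace ℝ (Fin N))) (p : ℝ)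
    (u : EuclideanSpace ℝ (Fin N) → ℝ)
    (G : EuclideanSpace ℝ (Fin N) → EuclideanSpace ℝ (Fin N)) : Prop :=
  HasWeakGradient Ω u G ∧ MemLpLoc Ω (ENNReal.ofReal p) u ∧ MemLpLoc Ω (ENNReal.ofReal p) G

/-- `φ` is a nonnegative function in `W^{1,∞}(Ω)` with compact support in `Ω`, and `H` is its weak
gradient (the representative `φ` is chosen to vanish outside a compact subset of `Ω`). -/
def IsAdmissible {N : ℕ} (Ω : Opens (EuclideanSpace ℝ (Fin N)))
    (φ : EuclideanSpace ℝ (Fin N) → ℝ)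
    (H : EuclideanSpace ℝ (Fin N) → EuclideanSpace ℝ (Fin N)) : Prop :=
  HasWeakGradient Ω φ H ∧ MemLp φ ∞ (volume.restrict Ω) ∧ MemLp H ∞ (volume.restrict Ω) ∧
    HasCompactSupport φ ∧ tsupport φ ⊆ (Ω : Set _) ∧ ∀ᵐ x ∂volume.restrict Ω, 0 ≤ φ x

/-- `A : Ω × [0,∞) × ℝ^N → ℝ^N` is a Carathéodory function (values of `A` off this set are
irrelevant). -/
structure IsCaratheodory {N : ℕ} (Ω : Opens (EuclideanSpace ℝ (Fin N)))
    (A : EuclideanSpace ℝ (Fin N) → ℝ → EuclideanSpace ℝ (Fin N) → EuclideanSpace ℝ (Fin N)) :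
    Prop where
  measurable : ∀ s : ℝ, 0 ≤ s → ∀ η : EuclideanSpace ℝ (Fin N),
    AEStronglyMeasurable (fun x => A x s η) (volume.restrict Ω)
  continuous : ∀ᵐ x ∂volume.restrict Ω,
    ContinuousOn (fun z : ℝ × EuclideanSpace ℝ (Fin N) => A x z.1 z.2) (Ici 0 ×ˢ univ)

/-- The operator `u ↦ div A(x, u, ∇u)` is weakly `p`-coercive in `Ω` with constant `K`. -/
def IsWeaklyCoercive {N : ℕ} (Ω : Opens (EuclideanSpace ℝ (Fin N))) (p K : ℝ)
    (A : EuclideanSpace ℝ (Fin N) → ℝ → EuclideanSpace ℝ (Fin N) → EuclideanSpace ℝ (Fin N)) :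
    Prop :=
  ∀ x ∈ Ω, ∀ s : ℝ, 0 ≤ s → ∀ η : EuclideanSpace ℝ (Fin N),
    K * ‖A x s η‖ ^ p.conjExponent ≤ inner ℝ (A x s η) η

/-- `u ∈ W^{1,p}_loc(Ω)` is a weak solution of `- div A(x, u, ∇u) ≥ g` in `Ω`. -/
def IsWeakSupersolution {N : ℕ} (Ω : Opens (EuclideanSpace ℝ (Fin N))) (p : ℝ)
    (A : EuclideanSpace ℝ (Fin N) → ℝ → EuclideanSpace ℝ (Fin N) → EuclideanSpace ℝ (Fin N))
    (g u : EuclideanSpace ℝ (Fin N) → ℝ) : Prop :=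
  ∃ G : EuclideanSpace ℝ (Fin N) → EuclideanSpace ℝ (Fin N),
    MemW1pLoc Ω p u G ∧
    MemLpLoc Ω (ENNReal.ofReal p.conjExponent) (fun x => A x (u x) (G x)) ∧
    ∀ φ H, IsAdmissible Ω φ H →
      ∫ x in (Ω : Set _), g x * φ x ≤ ∫ x in (Ω : Set _), inner ℝ (A x (u x) (G x)) (H x)

/-- `u ∈ W^{1,p}_loc(Ω)` is a weak solution of `- div A(x, u, ∇u) ≤ g` in `Ω`. -/
def IsWeakSubsolution {N : ℕ} (Ω : Opens (EuclideanSpace ℝ (Fin N))) (p : ℝ)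
    (A : EuclideanSpace ℝ (Fin N) → ℝ → EuclideanSpace ℝ (Fin N) → EuclideanSpace ℝ (Fin N))
    (g u : EuclideanSpace ℝ (Fin N) → ℝ) : Prop :=
  ∃ G : EuclideanSpace ℝ (Fin N) → EuclideanSpace ℝ (Fin N),
    MemW1pLoc Ω p u G ∧
    MemLpLoc Ω (ENNReal.ofReal p.conjExponent) (fun x => A x (u x) (G x)) ∧
    ∀ φ H, IsAdmissible Ω φ H →
      ∫ x in (Ω : Set _), inner ℝ (A x (u x) (G x)) (H x) ≤ ∫ x in (Ω : Set _), g x * φ x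

end QuasilinearEstimate

/-! Write `F` for the flux `A(x, u, ∇u)`, negated in the subsolution case so that both cases read `∫
f φ ≤ ∫ F · ∇φ`; only the sign `σ` in the coercivity bound `κ |F|^q ≤ σ F · ∇u` tells them apart.
Here `q = p'`. Testing with `ξ ^ λ` gives `∫ f ξ^λ ≤ λ D`, where `D = ∫ ξ^(λ-1) |F| |∇ξ|`, so the
task is to bound `D`.

Fix `T > 0` and `α = l/(p-1) - 1`, positive exactly because `l > p - 1`. Testing with `g(u) ξ^λ`,
where `g` takes values in `[0, T^(-α)]` and `g' = -σ α (u+T)^(-α-1)`, and dropping the nonnegative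
`f` term gives the energy bound `κ ∫ ξ^λ α (u+T)^(-α-1) |F|^q ≤ T^(-α) λ D`
(`integral_weighted_energy_le`). Young's inequality, weighted pointwise, splits `D` into this energy
and a remainder containing `(u+T)^((α+1)(p-1)) = (u+T)^l`. The energy part is at most `D/q` and is
absorbed, as `D` is finite. If `T^l` dominates the mean of `u^l` over `S_ξ`, the remainder is at
most a constant times `|S_ξ| max|∇ξ|^p T^(p-1)` (`integral_norm_mul_norm_gradient_le`). Letting `T`
decrease to the `l`-th root of the mean finishes the proof.

Since `u` is only in `W^{1,p}_loc`, `g(u) ξ^λ` need not be Lipschitz. The test uses `g(v) ξ^λ` with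
`v` a mollification of `u`; the bound obtained is independent of `v`, and a Fatou argument carries
it to `u` (`integral_inner_le_of_forall_contDiff`). -/

namespace QuasilinearEstimate

open Filter Topology ContinuousLinearMap

/-! ### Gradient calculus and smooth admissible test functions. -/

section Gradient

variable {E : Type*} [NormedAddCommGroup E] [InnerProductSpace ℝ E] [CompleteSpace E]

theorem inner_gradient_eq_fderiv (f : E → ℝ) (x v : E) : inner ℝ v (∇ f x) = fderiv ℝ f x v := by
  rw [real_inner_comm, gradient, InnerProductSpace.toDual_symm_apply]

theorem continuous_gradient {f : E → ℝ} (hf : ContDiff ℝ 1 f) : Continuous (∇ f) :=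
  (InnerProductSpace.toDual ℝ E).symm.continuous.comp (hf.continuous_fderiv one_ne_zero)

theorem support_gradient_subset (f : E → ℝ) : Function.support (∇ f) ⊆ tsupport f := by
  intro x hx
  apply support_fderiv_subset ℝ
  simp only [Function.mem_support, ne_eq, gradient] at hx ⊢
  contrapose! hx
  simp [hx]

theorem tsupport_gradient_subset (f : E → ℝ) : tsupport (∇ f) ⊆ tsupport f :=
  closure_minimal (support_gradient_subset f) (isClosed_tsupport f)

theorem hasCompactSupport_gradient {f : E → ℝ} (hf : HasCompactSupport f) :
    HasCompactSupport (∇ f) :=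
  hf.mono' (support_gradient_subset f)

/-- Scalar integration by parts, applied in each direction `v`. -/
theorem integral_smul_gradient_eq_neg [FiniteDimensional ℝ E] [MeasurableSpace E] [BorelSpace E]
    {μ : Measure E} [μ.IsAddHaarMeasure] {f g : E → ℝ} (hf : ContDiff ℝ 1 f) (hg : ContDiff ℝ 1 g)
    (hc : HasCompactSupport f) :
    ∫ x, f x • ∇ g x ∂μ = - ∫ x, g x • ∇ f x ∂μ := by
  have cf := hf.continuous
  have cg := hg.continuous
  have cf' := continuous_gradient hf
  have cg' := continuous_gradient hg
  have c1 : HasCompactSupport fun x => f x • ∇ g x := hc.smul_right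
  have c2 : HasCompactSupport fun x => g x • ∇ f x := (hasCompactSupport_gradient hc).smul_left
  have i1 : Integrable (fun x => f x • ∇ g x) μ :=
    (by fun_prop : Continuous fun x => f x • ∇ g x).integrable_of_hasCompactSupport c1
  have i2 : Integrable (fun x => g x • ∇ f x) μ :=
    (by fun_prop : Continuous fun x => g x • ∇ f x).integrable_of_hasCompactSupport c2
  refine ext_inner_left ℝ fun v => ?_
  have e1 := fun x => inner_smul_right v (∇ g x) (f x) (𝕜 := ℝ)
  have e2 := fun x => inner_smul_right v (∇ f x) (g x) (𝕜 := ℝ)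
  have j1 := i1.const_inner (𝕜 := ℝ) v
  have j2 := i2.const_inner (𝕜 := ℝ) v
  rw [inner_neg_right, ← integral_inner i1, ← integral_inner i2]
  simp only [e1, e2, inner_gradient_eq_fderiv] at j1 j2 ⊢
  simp only [mul_comm (g _)] at j2 ⊢
  exact integral_mul_fderiv_eq_neg_fderiv_mul_of_integrable j2 j1
    ((cf.mul cg).integrable_of_hasCompactSupport hc.mul_right)
    (fun x _ => hf.differentiable one_ne_zero x) (fun x _ => hg.differentiable one_ne_zero x)

theorem gradient_comp_mul_rpow {g : ℝ → ℝ} {v ξ : E → ℝ} {q : ℝ} (hq : 1 ≤ q) {x : E}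
    (hg : DifferentiableAt ℝ g (v x)) (hv : DifferentiableAt ℝ v x)
    (hξ : DifferentiableAt ℝ ξ x) :
    ∇ (fun y => g (v y) * ξ y ^ q) x =
      (ξ x ^ q * deriv g (v x)) • ∇ v x + (g (v x) * (q * ξ x ^ (q - 1))) • ∇ ξ x := by
  refine ext_inner_left ℝ fun z => ?_
  have h1 := hg.hasDerivAt.comp_hasFDerivAt x hv.hasFDerivAt
  have h2 := hξ.hasFDerivAt.rpow_const (p := q) (Or.inr hq)
  have h3 := (h1.mul h2).fderiv
  simp only [inner_add_right, inner_smul_right, inner_gradient_eq_fderiv]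
  erw [h3]
  simp
  ring

end Gradient

variable {N : ℕ} {Ω : Opens (EuclideanSpace ℝ (Fin N))}

theorem memLpLoc_of_continuous {F : Type*} [NormedAddCommGroup F]
    {g : EuclideanSpace ℝ (Fin N) → F} (hg : Continuous g)
    (q : ℝ≥0∞) : MemLpLoc Ω q g := by
  intro K hK _
  have : IsFiniteMeasure (volume.restrict K) := ⟨by simpa using hK.measure_lt_top⟩
  obtain ⟨C, hC⟩ := hK.exists_bound_of_continuousOn hg.continuousOn
  exact MemLp.of_bound (hg.continuousOn.aestronglyMeasurable_of_isCompact hK hK.measurableSet) C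
    (ae_restrict_of_forall_mem hK.measurableSet hC)

theorem isAdmissible_of_contDiff {φ : EuclideanSpace ℝ (Fin N) → ℝ} (hφ : ContDiff ℝ 1 φ)
    (hc : HasCompactSupport φ) (hs : tsupport φ ⊆ (Ω : Set _)) (h0 : ∀ x, 0 ≤ φ x) :
    IsAdmissible Ω φ (∇ φ) := by
  have cφ := continuous_gradient hφ
  refine ⟨⟨memLpLoc_of_continuous hφ.continuous 1, memLpLoc_of_continuous cφ 1, fun ψ => ?_⟩,
    ?_, ?_, hc, hs, Filter.Eventually.of_forall h0⟩
  · rw [setIntegral_eq_integral_of_forall_compl_eq_zero,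
      setIntegral_eq_integral_of_forall_compl_eq_zero]
    · exact integral_smul_gradient_eq_neg hφ (ψ.contDiff.of_le (by simp)) hc
    · intro x hx
      rw [image_eq_zero_of_notMem_tsupport fun h => hx (ψ.tsupport_subset h), zero_smul]
    · intro x hx
      rw [image_eq_zero_of_notMem_tsupport fun h => hx (hs h), zero_smul]
  · exact (hφ.continuous.memLp_top_of_hasCompactSupport hc _)
  · exact (cφ.memLp_top_of_hasCompactSupport (hasCompactSupport_gradient hc) _)

theorem mul_le_rpow_add_rpow {p q a b : ℝ} (hpq : p.HolderConjugate q) (ha : 0 ≤ a) (hb : 0 ≤ b) :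
    a * b ≤ a ^ p + b ^ q := by
  refine (Real.young_inequality_of_nonneg ha hb hpq).trans (add_le_add ?_ ?_)
  · exact div_le_self (by positivity) hpq.lt.le
  · exact div_le_self (by positivity) hpq.symm.lt.le

/-! ### Mollification of `u` and of its weak gradient. -/

section Convolution

variable {E : Type*} [NormedAddCommGroup E] [InnerProductSpace ℝ E] [FiniteDimensional ℝ E]
  [MeasurableSpace E] [BorelSpace E] {μ : Measure E} [μ.IsAddHaarMeasure]

theorem gradient_convolution {ρ g : E → ℝ} (hρ : ContDiff ℝ 1 ρ) (hc : HasCompactSupport ρ)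
    (hg : LocallyIntegrable g μ) (x : E) :
    ∇ (convolution ρ g (lsmul ℝ ℝ) μ) x = ∫ y, g y • ∇ ρ (x - y) ∂μ := by
  have hd := hc.hasFDerivAt_convolution_left (lsmul ℝ ℝ) hρ hg x
  have he := (((hc.fderiv ℝ).convolutionExists_left ((lsmul ℝ ℝ : ℝ →L[ℝ] ℝ →L[ℝ] ℝ).precompL E)
    (hρ.continuous_fderiv one_ne_zero) hg) x).integrable_swap
  refine ext_inner_left ℝ fun z => ?_
  rw [inner_gradient_eq_fderiv, hd.fderiv, convolution_eq_swap, integral_apply he,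
    ← integral_inner]
  · congr 1 with y
    rw [inner_smul_right, inner_gradient_eq_fderiv]
    simp [precompL_apply, mul_comm]
  · have := ((hasCompactSupport_gradient hc).convolutionExists_left
      ((lsmul ℝ ℝ : ℝ →L[ℝ] E →L[ℝ] E).flip) (continuous_gradient hρ) hg x).integrable_swap
    simpa using this

theorem convolution_nonneg_of_ae {ρ g : E → ℝ} (hρ : ∀ x, 0 ≤ ρ x) (hg : ∀ᵐ x ∂μ, 0 ≤ g x)
    (x : E) : 0 ≤ convolution ρ g (lsmul ℝ ℝ) μ x := by
  rw [convolution_eq_swap]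
  refine integral_nonneg_of_ae ?_
  filter_upwards [hg] with y hy
  exact mul_nonneg (hρ _) hy

/-- Young's inequality under the integral against the probability density `ρ`. The last term has the
same total integral as `‖g‖ ^ p`, which is what the Fatou argument needs of a majorant. -/
theorem abs_inner_convolution_le {ρ : E → ℝ} {g : E → E} {p q : ℝ} (hpq : p.HolderConjugate q)
    (hρ : Continuous ρ) (hc : HasCompactSupport ρ) (h0 : ∀ x, 0 ≤ ρ x) (h1 : ∫ x, ρ x ∂μ = 1)
    (hg : LocallyIntegrable g μ) (hgp : LocallyIntegrable (fun x => ‖g x‖ ^ p) μ) (x z : E) :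
    |inner ℝ z (convolution ρ g (lsmul ℝ ℝ) μ x)| ≤
      ‖z‖ ^ q + convolution ρ (fun x => ‖g x‖ ^ p) (lsmul ℝ ℝ) μ x := by
  have i1 := hc.convolutionExists_left (lsmul ℝ ℝ : ℝ →L[ℝ] E →L[ℝ] E) hρ hg x
  have i2 := hc.convolutionExists_left (lsmul ℝ ℝ : ℝ →L[ℝ] ℝ →L[ℝ] ℝ) hρ hgp x
  have i3 : Integrable (fun t => ρ t * ‖z‖ ^ q) μ :=
    (hρ.integrable_of_hasCompactSupport hc).mul_const _
  unfold ConvolutionExistsAt at i1 i2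
  simp only [lsmul_apply] at i1 i2
  have e : ‖z‖ ^ q = ∫ t, ρ t * ‖z‖ ^ q ∂μ := by rw [integral_mul_const, h1, one_mul]
  rw [e, convolution_def, convolution_def]
  simp only [lsmul_apply]
  rw [← integral_add i3 i2, ← integral_inner i1]
  refine abs_integral_le_integral_abs.trans
    (integral_mono (i1.const_inner z).abs (i3.add i2) fun t => ?_)
  simp only [inner_smul_right, smul_eq_mul]
  rw [abs_mul, abs_of_nonneg (h0 t), ← mul_add]
  refine mul_le_mul_of_nonneg_left ((abs_real_inner_le_norm _ _).trans ?_) (h0 t)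
  exact mul_le_rpow_add_rpow hpq.symm (norm_nonneg _) (norm_nonneg _)

end Convolution

/-- The function `ρ(x - ·)` is itself a test function in the definition of the weak gradient, since
its support stays inside `K`. -/
theorem gradient_mollification {u : EuclideanSpace ℝ (Fin N) → ℝ}
    {G : EuclideanSpace ℝ (Fin N) → EuclideanSpace ℝ (Fin N)} (hw : HasWeakGradient Ω u G)
    {K : Set (EuclideanSpace ℝ (Fin N))} (hK : IsCompact K) (hKΩ : K ⊆ (Ω : Set _))
    {ρ : EuclideanSpace ℝ (Fin N) → ℝ} (hρ : ContDiff ℝ ((⊤ : ℕ∞) : WithTop ℕ∞) ρ) (hc : HasCompactSupport ρ)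
    {x : EuclideanSpace ℝ (Fin N)} (hx : ∀ y, x - y ∈ tsupport ρ → y ∈ K) :
    ∇ (convolution ρ (K.indicator u) (lsmul ℝ ℝ) volume) x =
      convolution ρ (K.indicator G) (lsmul ℝ ℝ) volume x := by
  have hu : Integrable (K.indicator u) :=
    (integrable_indicator_iff hK.measurableSet).2 (memLp_one_iff_integrable.1 (hw.1 K hK hKΩ))
  rw [gradient_convolution (hρ.of_le (by simp)) hc hu.locallyIntegrable, convolution_eq_swap]
  have hcs : HasCompactSupport fun y => ρ (x - y) := hc.comp_homeomorph (Homeomorph.subLeft x)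
  have hts : tsupport (fun y => ρ (x - y)) ⊆ K := by
    refine closure_minimal (fun y hy => hx y (subset_tsupport _ hy)) hK.isClosed
  have hψ := hw.2.2 ⟨fun y => ρ (x - y), hρ.comp (by fun_prop), hcs, hts.trans hKΩ⟩
  have hgrad : ∀ y, ∇ (fun y => ρ (x - y)) y = - ∇ ρ (x - y) := by
    intro y
    refine ext_inner_left ℝ fun z => ?_
    have hd := ((hρ.differentiable (by simp)) (x - y)).hasFDerivAt.comp y
      ((hasFDerivAt_id y).const_sub x)
    rw [inner_neg_right, inner_gradient_eq_fderiv, inner_gradient_eq_fderiv]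
    erw [hd.fderiv]
    simp
  change ∫ y in (Ω : Set _), u y • ∇ (fun y => ρ (x - y)) y =
    - ∫ y in (Ω : Set _), ρ (x - y) • G y at hψ
  simp only [hgrad, smul_neg, integral_neg, neg_inj] at hψ
  have z1 : ∀ y, y ∉ K → ρ (x - y) = 0 := fun y hy =>
    image_eq_zero_of_notMem_tsupport fun h => hy (hx y h)
  have z2 : ∀ y, y ∉ K → ∇ ρ (x - y) = 0 := fun y hy =>
    image_eq_zero_of_notMem_tsupport fun h => hy (hx y (tsupport_gradient_subset _ h))
  rw [setIntegral_eq_integral_of_forall_compl_eq_zero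
      (fun y hy => by rw [z2 y fun h => hy (hKΩ h), smul_zero]),
    setIntegral_eq_integral_of_forall_compl_eq_zero
      (fun y hy => by rw [z1 y fun h => hy (hKΩ h), zero_smul])] at hψ
  have e1 : (fun y => K.indicator u y • ∇ ρ (x - y)) = fun y => u y • ∇ ρ (x - y) := by
    ext1 y
    by_cases hy : y ∈ K
    · simp [hy]
    · simp [hy, z2 y hy]
  have e2 : (fun y => lsmul ℝ ℝ (ρ (x - y)) (K.indicator G y)) = fun y => ρ (x - y) • G y := by
    ext1 y
    by_cases hy : y ∈ K
    · simp [hy]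
    · simp [hy, z1 y hy]
  rw [e1, e2, hψ]

theorem exists_mollification {u : EuclideanSpace ℝ (Fin N) → ℝ}
    {G : EuclideanSpace ℝ (Fin N) → EuclideanSpace ℝ (Fin N)} {p q : ℝ}
    (hpq : p.HolderConjugate q) (hw : HasWeakGradient Ω u G)
    (hG : MemLpLoc Ω (ENNReal.ofReal p) G) (hu : ∀ᵐ x ∂volume.restrict Ω, 0 ≤ u x)
    {K : Set (EuclideanSpace ℝ (Fin N))} (hK : IsCompact K) (hKΩ : K ⊆ (Ω : Set _)) :
    ∃ (v R : ℕ → EuclideanSpace ℝ (Fin N) → ℝ) (R₀ : EuclideanSpace ℝ (Fin N) → ℝ),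
      (∀ n, ContDiff ℝ 1 (v n)) ∧ (∀ n x, 0 ≤ v n x) ∧
      (∀ᵐ x, x ∈ K → Tendsto (fun n => v n x) atTop (𝓝 (u x))) ∧
      (∀ᵐ x, x ∈ K → Tendsto (fun n => ∇ (v n) x) atTop (𝓝 (G x))) ∧
      (∀ n, ∀ x ∈ K, ∀ z, |inner ℝ z (∇ (v n) x)| ≤ ‖z‖ ^ q + R n x) ∧
      (∀ n x, 0 ≤ R n x) ∧ (∀ n, Integrable (R n)) ∧ Integrable R₀ ∧
      (∀ᵐ x, Tendsto (fun n => R n x) atTop (𝓝 (R₀ x))) ∧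
      ∀ n, ∫ x, R n x = ∫ x, R₀ x := by
  -- Mollifying the cut-off to a thickening of `K`, at radii at most `δ`, keeps the truncation
  -- invisible from points of `K`.
  obtain ⟨δ, hδ, hδΩ⟩ := hK.exists_cthickening_subset_open Ω.isOpen hKΩ
  have hK' : IsCompact (Metric.cthickening δ K) := hK.cthickening
  have hKK' : K ⊆ Metric.cthickening δ K := Metric.self_subset_cthickening K
  set K' := Metric.cthickening δ K
  have ha : ∀ n : ℕ, 0 < δ / (n + 1) := fun n => by positivity
  -- The fixed ratio of inner to outer radius is what gives almost everywhere convergence at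
  -- Lebesgue points.
  let φ : ℕ → ContDiffBump (0 : EuclideanSpace ℝ (Fin N)) := fun n =>
    ⟨δ / (n + 1) / 2, δ / (n + 1), by have := ha n; positivity, by have := ha n; linarith⟩
  let ρ : ℕ → EuclideanSpace ℝ (Fin N) → ℝ := fun n => (φ n).normed volume
  have hφ0 : Tendsto (fun n => (φ n).rOut) atTop (𝓝 0) := by
    simpa [φ, div_eq_mul_inv] using
      (tendsto_one_div_add_atTop_nhds_zero_nat (𝕜 := ℝ)).const_mul δ
  have hφ2 : ∀ᶠ n in atTop, (φ n).rOut ≤ 2 * (φ n).rIn := by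
    filter_upwards with n
    change δ / (n + 1) ≤ 2 * (δ / (n + 1) / 2)
    linarith
  have hρ : ∀ n, ContDiff ℝ ((⊤ : ℕ∞) : WithTop ℕ∞) (ρ n) := fun n => (φ n).contDiff_normed
  have hρc : ∀ n, HasCompactSupport (ρ n) := fun n => (φ n).hasCompactSupport_normed
  have hρ0 : ∀ n x, 0 ≤ ρ n x := fun n x => (φ n).nonneg_normed x
  have hρ1 : ∀ n, ∫ x, ρ n x = 1 := fun n => (φ n).integral_normed
  have hx : ∀ n, ∀ x ∈ K, ∀ y, x - y ∈ tsupport (ρ n) → y ∈ K' := by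
    intro n x hx y hy
    rw [(φ n).tsupport_normed_eq, mem_closedBall_zero_iff] at hy
    refine Metric.mem_cthickening_of_dist_le y x δ K hx ?_
    rw [dist_comm, dist_eq_norm]
    refine hy.trans (div_le_self hδ.le ?_)
    linarith [n.cast_nonneg (α := ℝ)]
  have iu : Integrable (K'.indicator u) :=
    (integrable_indicator_iff hK'.measurableSet).2
      (memLp_one_iff_integrable.1 (hw.1 K' hK' hδΩ))
  have iG : Integrable (K'.indicator G) :=
    (integrable_indicator_iff hK'.measurableSet).2
      (memLp_one_iff_integrable.1 (hw.2.1 K' hK' hδΩ))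
  have iGp : Integrable (fun x => ‖K'.indicator G x‖ ^ p) := by
    have := (integrable_indicator_iff hK'.measurableSet).2
      ((hG K' hK' hδΩ).integrable_norm_rpow (by simpa using hpq.pos) ENNReal.ofReal_ne_top)
    rw [ENNReal.toReal_ofReal hpq.nonneg] at this
    convert! this using 2 with x
    by_cases hx : x ∈ K' <;> simp [hx, hpq.ne_zero]
  have hu0 : ∀ᵐ x, 0 ≤ K'.indicator u x := by
    filter_upwards [(ae_restrict_iff' Ω.isOpen.measurableSet).1 hu] with x hx
    by_cases h : x ∈ K'
    · simpa [h] using hx (hδΩ h)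
    · simp [h]
  have hgr : ∀ n, ∀ x ∈ K, ∇ (convolution (ρ n) (K'.indicator u) (lsmul ℝ ℝ) volume) x =
      convolution (ρ n) (K'.indicator G) (lsmul ℝ ℝ) volume x := fun n x h =>
    gradient_mollification hw hK' hδΩ (hρ n) (hρc n) (hx n x h)
  refine ⟨fun n => convolution (ρ n) (K'.indicator u) (lsmul ℝ ℝ) volume,
    fun n => convolution (ρ n) (fun x => ‖K'.indicator G x‖ ^ p) (lsmul ℝ ℝ) volume,
    fun x => ‖K'.indicator G x‖ ^ p, fun n => ?_, fun n x => ?_, ?_, ?_, fun n x h z => ?_,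
    fun n x => ?_, fun n => ?_, iGp, ?_, fun n => ?_⟩
  · exact (hρc n).contDiff_convolution_left _ ((hρ n).of_le (by simp)) iu.locallyIntegrable
  · exact convolution_nonneg_of_ae (hρ0 n) hu0 x
  · filter_upwards [ContDiffBump.ae_convolution_tendsto_right_of_locallyIntegrable hφ0 hφ2
      iu.locallyIntegrable] with x hx h
    simpa [hKK' h] using hx
  · filter_upwards [ContDiffBump.ae_convolution_tendsto_right_of_locallyIntegrable hφ0 hφ2
      iG.locallyIntegrable] with x hx h
    simp only [hgr _ x h]
    simpa [hKK' h] using hx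
  · rw [hgr n x h]
    exact abs_inner_convolution_le hpq (hρ n).continuous (hρc n) (hρ0 n) (hρ1 n)
      iG.locallyIntegrable iGp.locallyIntegrable x z
  · exact convolution_nonneg_of_ae (hρ0 n) (ae_of_all _ fun x => by positivity) x
  · exact ((hρ n).continuous.integrable_of_hasCompactSupport (hρc n)).integrable_convolution _ iGp
  · exact ContDiffBump.ae_convolution_tendsto_right_of_locallyIntegrable hφ0 hφ2
      iGp.locallyIntegrable
  · rw [integral_convolution _ ((hρ n).continuous.integrable_of_hasCompactSupport (hρc n)) iGp,
      hρ1]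
    simp

/-! ### Limit passage and test functions `g(v) ξ^λ`. -/

/-- Fatou's lemma for `h n + R n ≥ 0`. As `R n` loses no mass in the limit, its integral can be
subtracted again afterwards. -/
theorem integral_le_of_tendsto_of_neg_le {α : Type*} [MeasurableSpace α] {μ : Measure α}
    {h R : ℕ → α → ℝ} {h₀ R₀ : α → ℝ} {c : ℝ} (ih : ∀ n, Integrable (h n) μ)
    (ih₀ : Integrable h₀ μ) (iR : ∀ n, Integrable (R n) μ) (iR₀ : Integrable R₀ μ)
    (lh : ∀ᵐ x ∂μ, Tendsto (fun n => h n x) atTop (𝓝 (h₀ x)))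
    (lR : ∀ᵐ x ∂μ, Tendsto (fun n => R n x) atTop (𝓝 (R₀ x)))
    (hR : ∀ n, ∀ᵐ x ∂μ, -R n x ≤ h n x) (eR : ∀ n, ∫ x, R n x ∂μ = ∫ x, R₀ x ∂μ)
    (hc : ∀ n, ∫ x, h n x ∂μ ≤ c) : ∫ x, h₀ x ∂μ ≤ c := by
  have nn : ∀ n, 0 ≤ᵐ[μ] fun x => h n x + R n x := fun n => by
    filter_upwards [hR n] with x hx
    simp only [Pi.zero_apply]
    linarith
  have ll : ∀ᵐ x ∂μ, Tendsto (fun n => h n x + R n x) atTop (𝓝 (h₀ x + R₀ x)) := by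
    filter_upwards [lh, lR] with x h1 h2 using h1.add h2
  have nn₀ : 0 ≤ᵐ[μ] fun x => h₀ x + R₀ x := by
    filter_upwards [ll, ae_all_iff.2 nn] with x h1 h2
    exact ge_of_tendsto' h1 h2
  have bd : ∀ n, ∫ x, h n x + R n x ∂μ ≤ c + ∫ x, R₀ x ∂μ := fun n => by
    rw [integral_add (ih n) (iR n), eR n]
    linarith [hc n]
  have key : ∫⁻ x, ENNReal.ofReal (h₀ x + R₀ x) ∂μ ≤ ENNReal.ofReal (c + ∫ x, R₀ x ∂μ) := by
    calc ∫⁻ x, ENNReal.ofReal (h₀ x + R₀ x) ∂μ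
        = ∫⁻ x, liminf (fun n => ENNReal.ofReal (h n x + R n x)) atTop ∂μ := by
          refine lintegral_congr_ae ?_
          filter_upwards [ll] with x hx
          exact ((ENNReal.continuous_ofReal.tendsto _).comp hx).liminf_eq.symm
      _ ≤ liminf (fun n => ∫⁻ x, ENNReal.ofReal (h n x + R n x) ∂μ) atTop :=
          lintegral_liminf_le' fun n =>
            ((ih n).add (iR n)).aestronglyMeasurable.aemeasurable.ennreal_ofReal
      _ ≤ ENNReal.ofReal (c + ∫ x, R₀ x ∂μ) := by
          refine liminf_le_of_le (by isBoundedDefault) fun b hb => ?_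
          obtain ⟨n, hn⟩ := hb.exists
          refine hn.trans ?_
          refine (ofReal_integral_eq_lintegral_ofReal ((ih n).add (iR n)) (nn n)).symm.le.trans ?_
          exact ENNReal.ofReal_le_ofReal (bd n)
  replace key := (ofReal_integral_eq_lintegral_ofReal (ih₀.add iR₀) nn₀).le.trans key
  simp only [Pi.add_apply] at key
  rw [ENNReal.ofReal_le_ofReal_iff ((integral_nonneg_of_ae (nn 0)).trans (bd 0)),
    integral_add ih₀ iR₀] at key
  linarith

theorem integrableOn_inner_of_continuous {K : Set (EuclideanSpace ℝ (Fin N))} (hK : IsCompact K)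
    {F H : EuclideanSpace ℝ (Fin N) → EuclideanSpace ℝ (Fin N)}
    (hF : IntegrableOn F K) (hH : Continuous H) :
    IntegrableOn (fun x => inner ℝ (F x) (H x)) K := by
  obtain ⟨C, hC⟩ := hK.exists_bound_of_continuousOn hH.continuousOn
  refine (hF.norm.const_mul C).mono'
    (hF.aestronglyMeasurable.inner hH.aestronglyMeasurable) ?_
  filter_upwards [ae_restrict_mem hK.measurableSet] with x hx
  refine (norm_inner_le_norm _ _).trans ?_
  rw [mul_comm]
  exact mul_le_mul_of_nonneg_right (hC x hx) (norm_nonneg _)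

/-- Product rule for the gradient of `g(v) ξ^λ`. The term with `∇v` is kept exactly, because its
sign carries the coercivity once `v` is replaced by `u`; the term with `∇ξ` is bounded by
Cauchy–Schwarz and `g ≤ B`. -/
theorem integral_test_le {F : EuclideanSpace ℝ (Fin N) → EuclideanSpace ℝ (Fin N)}
    {f : EuclideanSpace ℝ (Fin N) → ℝ} {ξ : 𝓓(Ω, ℝ)} {lam B : ℝ} (hlam : 1 ≤ lam)
    (hξ : ∀ x, 0 ≤ ξ x) (hF : IntegrableOn F (tsupport ξ))
    (htest : ∀ φ H, IsAdmissible Ω φ H →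
      ∫ x in (Ω : Set _), f x * φ x ≤ ∫ x in (Ω : Set _), inner ℝ (F x) (H x))
    {g : ℝ → ℝ} (hg : ∀ t, 0 ≤ t → ContDiffAt ℝ 1 g t) (hg0 : ∀ t, 0 ≤ t → 0 ≤ g t)
    (hgB : ∀ t, 0 ≤ t → g t ≤ B) {v : EuclideanSpace ℝ (Fin N) → ℝ} (hv : ContDiff ℝ 1 v)
    (hv0 : ∀ x, 0 ≤ v x) :
    ∫ x in (Ω : Set _), f x * (g (v x) * ξ x ^ lam) ≤
      (∫ x in tsupport ξ, ξ x ^ lam * deriv g (v x) * inner ℝ (F x) (∇ v x)) +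
        B * lam * ∫ x in tsupport ξ, ξ x ^ (lam - 1) * (‖F x‖ * ‖∇ ξ x‖) := by
  have hξ1 : ContDiff ℝ 1 ξ := ξ.contDiff.of_le (by simp)
  have hK : IsCompact (tsupport ξ) := ξ.hasCompactSupport
  have hlam0 : 0 < lam := by linarith
  have hξp : ContDiff ℝ 1 fun x => ξ x ^ lam := hξ1.rpow_const_of_le (by simpa using hlam)
  have hgv : ContDiff ℝ 1 fun x => g (v x) :=
    contDiff_iff_contDiffAt.2 fun x => (hg _ (hv0 x)).comp x hv.contDiffAt
  have hφ : ContDiff ℝ 1 fun x => g (v x) * ξ x ^ lam := hgv.mul hξp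
  have hsupp : Function.support (fun x => g (v x) * ξ x ^ lam) ⊆ Function.support ξ := by
    intro x hx
    contrapose! hx
    simp only [Function.mem_support, not_not] at hx ⊢
    rw [hx, Real.zero_rpow hlam0.ne', mul_zero]
  have hts : tsupport (fun x => g (v x) * ξ x ^ lam) ⊆ tsupport ξ := closure_mono hsupp
  have hadm := isAdmissible_of_contDiff (Ω := Ω) hφ (ξ.hasCompactSupport.mono hsupp)
    (hts.trans ξ.tsupport_subset) fun x =>
      mul_nonneg (hg0 _ (hv0 x)) (Real.rpow_nonneg (hξ x) _)
  refine (htest _ _ hadm).trans ?_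
  have c1 : Continuous fun x => (ξ x ^ lam * deriv g (v x)) • ∇ v x := by
    have : Continuous fun x => deriv g (v x) := by
      refine continuous_iff_continuousAt.2 fun x => ?_
      have h := ((hg _ (hv0 x)).fderiv_right (m := 0) (by simp)).continuousAt
      have h2 := h.comp (f := v) hv.continuous.continuousAt
      simpa using h2.clm_apply (continuousAt_const (y := (1 : ℝ)))
    exact (hξp.continuous.mul this).smul (continuous_gradient hv)
  have cξ : Continuous fun x => ξ x ^ (lam - 1) :=
    ξ.continuous.rpow_const fun x => Or.inr (by linarith)
  have c2 : Continuous fun x => (g (v x) * (lam * ξ x ^ (lam - 1))) • ∇ ξ x :=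
    (hgv.continuous.mul (continuous_const.mul cξ)).smul (continuous_gradient hξ1)
  have i1 := integrableOn_inner_of_continuous hK hF c1
  have i2 := integrableOn_inner_of_continuous hK hF c2
  have i3 : IntegrableOn (fun x => ξ x ^ (lam - 1) * (‖F x‖ * ‖∇ ξ x‖)) (tsupport ξ) := by
    have h := IntegrableOn.mul_continuousOn (Integrable.norm hF)
      (cξ.mul (continuous_gradient hξ1).norm).continuousOn hK
    refine h.congr (ae_of_all _ fun x => ?_)
    simp only [Pi.mul_apply]
    ring
  rw [setIntegral_eq_of_subset_of_forall_sdiff_eq_zero Ω.isOpen.measurableSet ξ.tsupport_subset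
    (fun x hx => by
      rw [image_eq_zero_of_notMem_tsupport fun h => hx.2 (hts (tsupport_gradient_subset _ h)),
        inner_zero_right])]
  have e : ∀ x, inner ℝ (F x) (∇ (fun y => g (v y) * ξ y ^ lam) x) =
      inner ℝ (F x) ((ξ x ^ lam * deriv g (v x)) • ∇ v x) +
        inner ℝ (F x) ((g (v x) * (lam * ξ x ^ (lam - 1))) • ∇ ξ x) := fun x => by
    rw [gradient_comp_mul_rpow hlam ((hg _ (hv0 x)).differentiableAt one_ne_zero)
      (hv.differentiable one_ne_zero x) (hξ1.differentiable one_ne_zero x), inner_add_right]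
  simp only [e]
  rw [integral_add i1 i2, ← integral_const_mul]
  simp only [inner_smul_right (F _) (∇ v _)]
  refine add_le_add le_rfl (integral_mono i2 (i3.const_mul _) fun x => ?_)
  simp only [inner_smul_right]
  have h1 : inner ℝ (F x) (∇ ξ x) ≤ ‖F x‖ * ‖∇ ξ x‖ := real_inner_le_norm _ _
  have h2 : 0 ≤ ξ x ^ (lam - 1) := Real.rpow_nonneg (hξ x) _
  calc g (v x) * (lam * ξ x ^ (lam - 1)) * inner ℝ (F x) (∇ ξ x)
      ≤ g (v x) * (lam * ξ x ^ (lam - 1)) * (‖F x‖ * ‖∇ ξ x‖) :=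
        mul_le_mul_of_nonneg_left h1 (mul_nonneg (hg0 _ (hv0 x)) (by positivity))
    _ ≤ B * (lam * ξ x ^ (lam - 1)) * (‖F x‖ * ‖∇ ξ x‖) :=
        mul_le_mul_of_nonneg_right
          (mul_le_mul_of_nonneg_right (hgB _ (hv0 x)) (by positivity)) (by positivity)
    _ = B * lam * (ξ x ^ (lam - 1) * (‖F x‖ * ‖∇ ξ x‖)) := by ring

/-- Coercivity controls `F · G` but says nothing about `F · ∇v`, so the inequality has to reach `u`
before coercivity is used. This is possible because `c` does not depend on `v`. -/
theorem integral_inner_le_of_forall_contDiff {u : EuclideanSpace ℝ (Fin N) → ℝ}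
    {F G : EuclideanSpace ℝ (Fin N) → EuclideanSpace ℝ (Fin N)} {p q : ℝ}
    (hpq : p.HolderConjugate q) (hw : HasWeakGradient Ω u G)
    (hG : MemLpLoc Ω (ENNReal.ofReal p) G) (hu : ∀ᵐ x ∂volume.restrict Ω, 0 ≤ u x)
    {K : Set (EuclideanSpace ℝ (Fin N))} (hK : IsCompact K) (hKΩ : K ⊆ (Ω : Set _))
    (hF : IntegrableOn F K) (hFq : IntegrableOn (fun x => ‖F x‖ ^ q) K)
    {η : EuclideanSpace ℝ (Fin N) → ℝ} (hη : Continuous η) (hη0 : ∀ x, 0 ≤ η x)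
    (hη1 : ∀ x, η x ≤ 1) {w : ℝ → ℝ} {W : ℝ} (hwm : Measurable w) (hwc : ContinuousOn w (Ici 0))
    (hw0 : ∀ t, 0 ≤ t → 0 ≤ w t) (hwW : ∀ t, 0 ≤ t → w t ≤ W) {c : ℝ}
    (hc : ∀ v : EuclideanSpace ℝ (Fin N) → ℝ, ContDiff ℝ 1 v → (∀ x, 0 ≤ v x) →
      ∫ x in K, η x * w (v x) * inner ℝ (F x) (∇ v x) ≤ c) :
    IntegrableOn (fun x => η x * w (u x) * inner ℝ (F x) (G x)) K ∧
      ∫ x in K, η x * w (u x) * inner ℝ (F x) (G x) ≤ c := by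
  have hW : 0 ≤ W := (hw0 0 le_rfl).trans (hwW 0 le_rfl)
  obtain ⟨v, R, R₀, hv, hv0, hvu, hvG, hvR, hR0, iR, iR₀, lR, eR⟩ :=
    exists_mollification hpq hw hG hu hK hKΩ
  have huK : ∀ᵐ x ∂volume.restrict K, 0 ≤ u x := ae_restrict_of_ae_restrict_of_subset hKΩ hu
  have mu : AEMeasurable u (volume.restrict K) := (hw.1 K hK hKΩ).aestronglyMeasurable.aemeasurable
  have mG : AEStronglyMeasurable G (volume.restrict K) := (hG K hK hKΩ).aestronglyMeasurable
  have iGp : IntegrableOn (fun x => ‖G x‖ ^ p) K := by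
    have := (hG K hK hKΩ).integrable_norm_rpow (by simpa using hpq.pos) ENNReal.ofReal_ne_top
    rwa [ENNReal.toReal_ofReal hpq.nonneg] at this
  have bound : ∀ x t a b, 0 ≤ t → |a| ≤ b → |η x * w t * a| ≤ W * b := fun x t a b ht hab => by
    rw [abs_mul, abs_of_nonneg (mul_nonneg (hη0 x) (hw0 t ht))]
    refine mul_le_mul ?_ hab (abs_nonneg _) hW
    exact (mul_le_mul (hη1 x) (hwW t ht) (hw0 t ht) zero_le_one).trans (one_mul W).le
  have i₀ : IntegrableOn (fun x => η x * w (u x) * inner ℝ (F x) (G x)) K := by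
    refine ((hFq.add iGp).const_mul W).mono' ?_ ?_
    · exact (hη.aestronglyMeasurable.mul (hwm.comp_aemeasurable mu).aestronglyMeasurable).mul
        (hF.aestronglyMeasurable.inner mG)
    · filter_upwards [huK] with x hx
      refine bound x _ _ _ hx ((abs_real_inner_le_norm _ _).trans ?_)
      exact mul_le_rpow_add_rpow hpq.symm (norm_nonneg _) (norm_nonneg _)
  have i₁ : ∀ n, IntegrableOn (fun x => η x * w (v n x) * inner ℝ (F x) (∇ (v n) x)) K := by
    intro n
    have cw : Continuous fun x => w (v n x) :=
      hwc.comp_continuous (hv n).continuous (hv0 n)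
    have := integrableOn_inner_of_continuous hK hF (H := fun x => (η x * w (v n x)) • ∇ (v n) x)
      ((hη.mul cw).smul (continuous_gradient (hv n)))
    simpa only [inner_smul_right] using this
  refine ⟨i₀, ?_⟩
  have hm := hK.measurableSet
  rw [← integral_indicator hm]
  refine integral_le_of_tendsto_of_neg_le
    (h := fun n => K.indicator fun x => η x * w (v n x) * inner ℝ (F x) (∇ (v n) x))
    (R := fun n x => W * (K.indicator (fun x => ‖F x‖ ^ q) x + R n x))
    (R₀ := fun x => W * (K.indicator (fun x => ‖F x‖ ^ q) x + R₀ x))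
    (fun n => (integrable_indicator_iff hm).2 (i₁ n)) ((integrable_indicator_iff hm).2 i₀)
    (fun n => (((integrable_indicator_iff hm).2 hFq).add (iR n)).const_mul W)
    ((((integrable_indicator_iff hm).2 hFq).add iR₀).const_mul W) ?_ ?_ ?_ ?_ ?_
  · filter_upwards [hvu, hvG, (ae_restrict_iff' hm).1 huK] with x h1 h2 h3
    by_cases hx : x ∈ K
    · simp only [indicator_of_mem hx]
      have hwt : Tendsto (fun n => w (v n x)) atTop (𝓝 (w (u x))) :=
        (hwc (u x) (h3 hx)).tendsto.comp
          (tendsto_nhdsWithin_iff.2 ⟨h1 hx, Eventually.of_forall fun n => hv0 n x⟩)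
      exact (hwt.const_mul _).mul (tendsto_const_nhds.inner (h2 hx))
    · simp [hx]
  · filter_upwards [lR] with x hx
    exact (hx.const_add _).const_mul W
  · refine fun n => ae_of_all _ fun x => ?_
    by_cases hx : x ∈ K
    · simp only [indicator_of_mem hx]
      exact neg_le_of_abs_le (bound x _ _ _ (hv0 n x) (hvR n x hx (F x)))
    · simpa [hx] using mul_nonneg hW (hR0 n x)
  · intro n
    rw [integral_const_mul, integral_const_mul,
      integral_add ((integrable_indicator_iff hm).2 hFq) (iR n),
      integral_add ((integrable_indicator_iff hm).2 hFq) iR₀, eR n]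
  · intro n
    rw [integral_indicator hm]
    exact hc (v n) (hv n) (hv0 n)

/-! ### The weighted energy estimate and the bound on `D`. -/

theorem young_weighted {p q s a d k lam : ℝ} (hpq : p.HolderConjugate q) (hs0 : 0 ≤ s)
    (hs1 : s ≤ 1) (ha : 0 ≤ a) (hd : 0 ≤ d) (hk : 0 < k) (hlam : p ≤ lam) :
    s ^ (lam - 1) * (a * d) ≤ k * (s ^ lam * a ^ q) / q + k ^ (-(p - 1)) * d ^ p / p := by
  have hp := hpq.pos
  have hq := hpq.symm.pos
  have hlam0 : 0 < lam := hp.trans_le hlam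
  have h1 : 0 ≤ lam / p - 1 := by rw [sub_nonneg, le_div_iff₀ hp, one_mul]; exact hlam
  have e1 : lam - 1 = lam / q + (lam / p - 1) := by
    have := hpq.inv_add_inv_eq_one
    rw [div_eq_mul_inv, div_eq_mul_inv]
    linear_combination (-lam) * this
  have e2 : k ^ q⁻¹ * k ^ (-q⁻¹) = 1 := by rw [← Real.rpow_add hk]; simp
  have hY := Real.young_inequality_of_nonneg (a := k ^ q⁻¹ * s ^ (lam / q) * a)
    (b := k ^ (-q⁻¹) * s ^ (lam / p - 1) * d) (by positivity) (by positivity) hpq.symm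
  have e3 : (k ^ q⁻¹ * s ^ (lam / q) * a) ^ q = k * (s ^ lam * a ^ q) := by
    rw [Real.mul_rpow (by positivity) ha, Real.mul_rpow (by positivity) (by positivity),
      ← Real.rpow_mul hk.le, ← Real.rpow_mul hs0, inv_mul_cancel₀ hq.ne', Real.rpow_one,
      div_mul_cancel₀ _ hq.ne', mul_assoc]
  -- The leftover factor is `s ^ (lam - p)`, at most `1`; this is where `p ≤ lam` is needed.
  have e4 : (k ^ (-q⁻¹) * s ^ (lam / p - 1) * d) ^ p ≤ k ^ (-(p - 1)) * d ^ p := by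
    rw [Real.mul_rpow (by positivity) hd, Real.mul_rpow (by positivity) (by positivity),
      ← Real.rpow_mul hk.le]
    have : -q⁻¹ * p = -(p - 1) := by
      have h := hpq.inv_add_inv_eq_one
      have h' : p⁻¹ * p = 1 := inv_mul_cancel₀ hp.ne'
      linear_combination (-p) * h + h'
    rw [this]
    refine mul_le_mul_of_nonneg_right (mul_le_of_le_one_right (by positivity) ?_) (by positivity)
    exact Real.rpow_le_one (by positivity) (Real.rpow_le_one hs0 hs1 h1) hp.le
  calc s ^ (lam - 1) * (a * d)
      = k ^ q⁻¹ * s ^ (lam / q) * a * (k ^ (-q⁻¹) * s ^ (lam / p - 1) * d) := by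
        rw [e1, Real.rpow_add_of_nonneg hs0 (by positivity) h1]
        linear_combination (-(s ^ (lam / q) * s ^ (lam / p - 1) * (a * d))) * e2
    _ ≤ _ := hY
    _ ≤ _ := by
        rw [e3]
        gcongr

theorem add_rpow_le_two_rpow_mul {a b l : ℝ} (ha : 0 ≤ a) (hb : 0 ≤ b) (hl : 0 ≤ l) :
    (a + b) ^ l ≤ 2 ^ l * (a ^ l + b ^ l) := by
  have h : a + b ≤ 2 * max a b := by linarith [le_max_left a b, le_max_right a b]
  have hm : 0 ≤ max a b := ha.trans (le_max_left _ _)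
  refine (Real.rpow_le_rpow (by positivity) h hl).trans ?_
  rw [Real.mul_rpow zero_le_two hm]
  refine mul_le_mul_of_nonneg_left ?_ (by positivity)
  have ha' := Real.rpow_nonneg ha l
  have hb' := Real.rpow_nonneg hb l
  rcases max_choice a b with h | h <;> rw [h] <;> linarith

/-- Supersolutions (`σ = 1`) need a decreasing `g`, subsolutions (`σ = -1`) an increasing one.
Reflecting the power in the constant `T ^ (-α)` yields the second with the same bounds. -/
theorem exists_bounded_power_primitive {T α σ : ℝ} (hT : 0 < T) (hα : 0 < α)
    (hσ : σ = 1 ∨ σ = -1) :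
    ∃ g : ℝ → ℝ, (∀ t, 0 ≤ t → ContDiffAt ℝ 1 g t) ∧ (∀ t, 0 ≤ t → 0 ≤ g t) ∧
      (∀ t, 0 ≤ t → g t ≤ T ^ (-α)) ∧
      ∀ t, 0 ≤ t → deriv g t = -σ * (α * (t + T) ^ (-α - 1)) := by
  have hd : ∀ t, 0 ≤ t → HasDerivAt (fun t => (t + T) ^ (-α)) (-(α * (t + T) ^ (-α - 1))) t := by
    intro t ht
    have := ((hasDerivAt_id t).add_const T).rpow_const (p := -α) (Or.inl (by simp; positivity))
    convert! this using 1
    simp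
  have hc : ∀ t, 0 ≤ t → ContDiffAt ℝ 1 (fun t => (t + T) ^ (-α)) t := fun t ht =>
    ((contDiff_id.add contDiff_const).contDiffAt).rpow_const_of_ne (by simp; positivity)
  have h0 : ∀ t, 0 ≤ t → 0 ≤ (t + T) ^ (-α) := fun t ht => by positivity
  have h1 : ∀ t, 0 ≤ t → (t + T) ^ (-α) ≤ T ^ (-α) := fun t ht =>
    Real.rpow_le_rpow_of_nonpos hT (by linarith) (by linarith)
  rcases hσ with rfl | rfl
  · refine ⟨fun t => (t + T) ^ (-α), hc, h0, h1, fun t ht => ?_⟩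
    rw [(hd t ht).deriv]
    ring
  · refine ⟨fun t => T ^ (-α) - (t + T) ^ (-α), fun t ht => contDiffAt_const.sub (hc t ht),
      fun t ht => by linarith [h1 t ht], fun t ht => by linarith [h0 t ht], fun t ht => ?_⟩
    rw [((hd t ht).const_sub _).deriv]
    ring

theorem integral_weighted_energy_le {u f : EuclideanSpace ℝ (Fin N) → ℝ}
    {F G : EuclideanSpace ℝ (Fin N) → EuclideanSpace ℝ (Fin N)} {ξ : 𝓓(Ω, ℝ)}
    {p q lam T α σ κ : ℝ} (hpq : p.HolderConjugate q) (hlam : 1 ≤ lam)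
    (hw : HasWeakGradient Ω u G) (hG : MemLpLoc Ω (ENNReal.ofReal p) G)
    (hu : ∀ᵐ x ∂volume.restrict Ω, 0 ≤ u x) (hf : ∀ᵐ x ∂volume.restrict Ω, 0 ≤ f x)
    (hF : IntegrableOn F (tsupport ξ)) (hFq : IntegrableOn (fun x => ‖F x‖ ^ q) (tsupport ξ))
    (htest : ∀ φ H, IsAdmissible Ω φ H →
      ∫ x in (Ω : Set _), f x * φ x ≤ ∫ x in (Ω : Set _), inner ℝ (F x) (H x))
    (hξ : ∀ x, ξ x ∈ Icc (0 : ℝ) 1) (hT : 0 < T) (hα : 0 < α) (hσ : σ = 1 ∨ σ = -1)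
    (hcoer : ∀ᵐ x ∂volume.restrict Ω, κ * ‖F x‖ ^ q ≤ σ * inner ℝ (F x) (G x)) :
    IntegrableOn (fun x => ξ x ^ lam * (α * (u x + T) ^ (-α - 1)) * ‖F x‖ ^ q) (tsupport ξ) ∧
      κ * ∫ x in tsupport ξ, ξ x ^ lam * (α * (u x + T) ^ (-α - 1)) * ‖F x‖ ^ q ≤
        T ^ (-α) * lam * ∫ x in tsupport ξ, ξ x ^ (lam - 1) * (‖F x‖ * ‖∇ ξ x‖) := by
  obtain ⟨g, hg, hg0, hgB, hg'⟩ := exists_bounded_power_primitive hT hα hσ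
  have hK : IsCompact (tsupport ξ) := ξ.hasCompactSupport
  have hKΩ : tsupport ξ ⊆ (Ω : Set _) := ξ.tsupport_subset
  have hlam0 : 0 ≤ lam := by linarith
  have huK := ae_restrict_of_ae_restrict_of_subset hKΩ hu
  have hη : Continuous fun x => ξ x ^ lam := ξ.continuous.rpow_const fun x => Or.inr hlam0
  have hη0 : ∀ x, 0 ≤ ξ x ^ lam := fun x => Real.rpow_nonneg (hξ x).1 _
  have hη1 : ∀ x, ξ x ^ lam ≤ 1 := fun x => Real.rpow_le_one (hξ x).1 (hξ x).2 hlam0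
  have hwm : Measurable fun t : ℝ => α * (t + T) ^ (-α - 1) := by fun_prop
  have hw0 : ∀ t : ℝ, 0 ≤ t → 0 ≤ α * (t + T) ^ (-α - 1) := fun t ht => by positivity
  have hwW : ∀ t : ℝ, 0 ≤ t → α * (t + T) ^ (-α - 1) ≤ α * T ^ (-α - 1) := fun t ht =>
    mul_le_mul_of_nonneg_left
      (Real.rpow_le_rpow_of_nonpos hT (by linarith) (by linarith)) hα.le
  have hwc : ContinuousOn (fun t : ℝ => α * (t + T) ^ (-α - 1)) (Ici 0) := by
    refine continuousOn_const.mul (ContinuousOn.rpow_const (by fun_prop) fun t ht => Or.inl ?_)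
    have : (0 : ℝ) ≤ t := ht
    positivity
  have key := integral_inner_le_of_forall_contDiff (F := fun x => σ • F x) hpq hw hG hu hK hKΩ
    (hF.smul σ) (by
      rcases hσ with rfl | rfl <;> simpa using hFq) hη hη0 hη1 hwm hwc hw0 hwW
    (c := T ^ (-α) * lam * ∫ x in tsupport ξ, ξ x ^ (lam - 1) * (‖F x‖ * ‖∇ ξ x‖)) (by
      intro v hv hv0
      have h := integral_test_le hlam (fun x => (hξ x).1) hF htest hg hg0 hgB hv hv0
      have h0 : 0 ≤ ∫ x in (Ω : Set _), f x * (g (v x) * ξ x ^ lam) := by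
        refine integral_nonneg_of_ae ?_
        filter_upwards [hf] with x hx
        exact mul_nonneg hx (mul_nonneg (hg0 _ (hv0 x)) (hη0 x))
      have e : ∀ x, ξ x ^ lam * deriv g (v x) * inner ℝ (F x) (∇ v x) =
          -(ξ x ^ lam * (α * (v x + T) ^ (-α - 1)) * inner ℝ (σ • F x) (∇ v x)) := fun x => by
        rw [hg' _ (hv0 x), real_inner_smul_left]
        ring
      simp only [e, integral_neg] at h
      linarith)
  have i1 : IntegrableOn (fun x => ξ x ^ lam * (α * (u x + T) ^ (-α - 1)) * ‖F x‖ ^ q)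
      (tsupport ξ) := by
    have mu := (hw.1 _ hK hKΩ).aestronglyMeasurable.aemeasurable
    refine (hFq.const_mul (α * T ^ (-α - 1))).mono' ?_ ?_
    · exact (hη.aestronglyMeasurable.mul (hwm.comp_aemeasurable mu).aestronglyMeasurable).mul
        hFq.aestronglyMeasurable
    · filter_upwards [huK] with x hx
      have := hw0 _ hx
      rw [Real.norm_of_nonneg (mul_nonneg (mul_nonneg (hη0 x) this) (by positivity))]
      refine mul_le_mul_of_nonneg_right ?_ (by positivity)
      exact (mul_le_of_le_one_left this (hη1 x)).trans (hwW _ hx)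
  refine ⟨i1, le_trans ?_ key.2⟩
  rw [← integral_const_mul]
  refine integral_mono_ae (i1.const_mul κ) key.1 ?_
  filter_upwards [huK, ae_restrict_of_ae_restrict_of_subset hKΩ hcoer] with x hx hc
  simp only [real_inner_smul_left]
  have := mul_le_mul_of_nonneg_left hc (mul_nonneg (hη0 x) (hw0 _ hx))
  linarith

theorem integral_norm_mul_norm_gradient_le {u f : EuclideanSpace ℝ (Fin N) → ℝ}
    {F G : EuclideanSpace ℝ (Fin N) → EuclideanSpace ℝ (Fin N)} {ξ : 𝓓(Ω, ℝ)}
    {p q l lam T σ κ M : ℝ} (hpq : p.HolderConjugate q) (hl : p - 1 < l) (hlam : p ≤ lam)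
    (hw : HasWeakGradient Ω u G) (hG : MemLpLoc Ω (ENNReal.ofReal p) G)
    (hu : ∀ᵐ x ∂volume.restrict Ω, 0 ≤ u x) (hf : ∀ᵐ x ∂volume.restrict Ω, 0 ≤ f x)
    (hF : IntegrableOn F (tsupport ξ)) (hFq : IntegrableOn (fun x => ‖F x‖ ^ q) (tsupport ξ))
    (htest : ∀ φ H, IsAdmissible Ω φ H →
      ∫ x in (Ω : Set _), f x * φ x ≤ ∫ x in (Ω : Set _), inner ℝ (F x) (H x))
    (hξ : ∀ x, ξ x ∈ Icc (0 : ℝ) 1) (hT : 0 < T) (hσ : σ = 1 ∨ σ = -1) (hκ : 0 < κ)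
    (hcoer : ∀ᵐ x ∂volume.restrict Ω, κ * ‖F x‖ ^ q ≤ σ * inner ℝ (F x) (G x))
    (hM : ∀ x, ‖∇ ξ x‖ ≤ M) (hul : IntegrableOn (fun x => u x ^ l) (tsupport (∇ ξ)))
    (hulT : ∫ x in tsupport (∇ ξ), u x ^ l ≤ T ^ l * volume.real (tsupport (∇ ξ))) :
    ∫ x in tsupport ξ, ξ x ^ (lam - 1) * (‖F x‖ * ‖∇ ξ x‖) ≤
      (lam / (κ * (l / (p - 1) - 1))) ^ (p - 1) * 2 ^ (l + 1) *
        (volume.real (tsupport (∇ ξ)) * M ^ p * T ^ (p - 1)) := by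
  have hp1 : 0 < p - 1 := by linarith [hpq.lt]
  have hp := hpq.pos
  have hl0 : 0 < l := hp1.trans hl
  have hlam0 : 0 < lam := hp.trans_le hlam
  have hξ1 : ContDiff ℝ 1 ξ := ξ.contDiff.of_le (by simp)
  have hM0 : 0 ≤ M := (norm_nonneg _).trans (hM 0)
  set α := l / (p - 1) - 1 with hαdef
  have hα : 0 < α := by rw [hαdef, sub_pos, lt_div_iff₀ hp1]; linarith
  have hαl : (α + 1) * (p - 1) = l := by rw [hαdef]; field_simp; ring
  have hK : IsCompact (tsupport ξ) := ξ.hasCompactSupport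
  have hSK : tsupport (∇ ξ) ⊆ tsupport ξ := tsupport_gradient_subset _
  have hKΩ : tsupport ξ ⊆ (Ω : Set _) := ξ.tsupport_subset
  have hS : IsCompact (tsupport (∇ ξ)) := hasCompactSupport_gradient hK
  set S := tsupport (∇ ξ)
  obtain ⟨iX, hX⟩ := integral_weighted_energy_le hpq (hpq.lt.le.trans hlam) hw hG hu hf hF hFq
    htest hξ hT hα hσ hcoer
  have eD : ∫ x in tsupport ξ, ξ x ^ (lam - 1) * (‖F x‖ * ‖∇ ξ x‖) =
      ∫ x in S, ξ x ^ (lam - 1) * (‖F x‖ * ‖∇ ξ x‖) :=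
    setIntegral_eq_of_subset_of_forall_sdiff_eq_zero hK.measurableSet hSK
      (fun x hx => by rw [image_eq_zero_of_notMem_tsupport hx.2, norm_zero, mul_zero, mul_zero])
  set D := ∫ x in tsupport ξ, ξ x ^ (lam - 1) * (‖F x‖ * ‖∇ ξ x‖)
  set X := ∫ x in tsupport ξ, ξ x ^ lam * (α * (u x + T) ^ (-α - 1)) * ‖F x‖ ^ q
  have huK := ae_restrict_of_ae_restrict_of_subset hKΩ hu
  have huS := ae_restrict_of_ae_restrict_of_subset hSK huK
  -- Normalised so that the energy bound reads `k * X ≤ D`.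
  set k := κ * T ^ α / lam with hk
  have hk0 : 0 < k := by positivity
  have hkX : k * X ≤ D := by
    have : k * X = T ^ α / lam * (κ * X) := by rw [hk]; ring
    rw [this]
    refine (mul_le_mul_of_nonneg_left hX (by positivity)).trans (le_of_eq ?_)
    rw [Real.rpow_neg hT.le]
    field_simp
  have hXS : ∫ x in S, ξ x ^ lam * (α * (u x + T) ^ (-α - 1)) * ‖F x‖ ^ q ≤ X := by
    refine setIntegral_mono_set iX ?_ hSK.eventuallyLE
    filter_upwards [huK] with x hx
    have := (hξ x).1
    simp only [Pi.zero_apply]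
    positivity
  set c := (k * α) ^ (-(p - 1)) * M ^ p * 2 ^ l with hc
  have hc0 : 0 ≤ c := by positivity
  have : IsFiniteMeasure (volume.restrict S) := ⟨by simpa using hS.measure_lt_top⟩
  have iD : IntegrableOn (fun x => ξ x ^ (lam - 1) * (‖F x‖ * ‖∇ ξ x‖)) S := by
    have cξ : Continuous fun x => ξ x ^ (lam - 1) :=
      ξ.continuous.rpow_const fun x => Or.inr (by linarith)
    have h := IntegrableOn.mul_continuousOn (Integrable.norm (hF.mono_set hSK))
      (cξ.mul (continuous_gradient hξ1).norm).continuousOn hS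
    refine h.congr (ae_of_all _ fun x => ?_)
    simp only [Pi.mul_apply]
    ring
  have iX' := iX.mono_set hSK
  have iuT : IntegrableOn (fun x => u x ^ l + T ^ l) S := hul.add (integrable_const _)
  have main : D ≤ D / q + c * (2 * (T ^ l * volume.real S)) / p := by
    calc D = ∫ x in S, ξ x ^ (lam - 1) * (‖F x‖ * ‖∇ ξ x‖) := eD
      _ ≤ ∫ x in S, (k / q * (ξ x ^ lam * (α * (u x + T) ^ (-α - 1)) * ‖F x‖ ^ q) +
            c / p * (u x ^ l + T ^ l)) := by
          refine integral_mono_ae iD ((iX'.const_mul _).add (iuT.const_mul _)) ?_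
          filter_upwards [huS] with x hx
          -- The Young parameter depends on `x`: it reproduces the energy density in the first term
          -- and turns the second into a multiple of `(u x + T) ^ l`.
          have hy := young_weighted (k := k * (α * (u x + T) ^ (-α - 1))) hpq (hξ x).1 (hξ x).2
            (norm_nonneg (F x)) (norm_nonneg (∇ ξ x)) (by positivity) hlam
          refine hy.trans ?_
          refine add_le_add (le_of_eq (by ring)) ?_
          rw [div_mul_eq_mul_div c p]
          refine div_le_div_of_nonneg_right ?_ hp.le
          have e : (k * (α * (u x + T) ^ (-α - 1))) ^ (-(p - 1)) =
              (k * α) ^ (-(p - 1)) * (u x + T) ^ l := by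
            rw [← mul_assoc, Real.mul_rpow (by positivity) (by positivity),
              ← Real.rpow_mul (by positivity)]
            congr 2
            linear_combination hαl
          rw [e, hc]
          have h1 : ‖∇ ξ x‖ ^ p ≤ M ^ p := Real.rpow_le_rpow (norm_nonneg _) (hM x) hp.le
          calc (k * α) ^ (-(p - 1)) * (u x + T) ^ l * ‖∇ ξ x‖ ^ p
              ≤ (k * α) ^ (-(p - 1)) * (2 ^ l * (u x ^ l + T ^ l)) * M ^ p := by
                have := add_rpow_le_two_rpow_mul hx hT.le hl0.le
                gcongr
            _ = _ := by ring
      _ = k / q * (∫ x in S, ξ x ^ lam * (α * (u x + T) ^ (-α - 1)) * ‖F x‖ ^ q) +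
            c / p * ∫ x in S, (u x ^ l + T ^ l) := by
          rw [integral_add (iX'.const_mul _) (iuT.const_mul _), integral_const_mul,
            integral_const_mul]
      _ ≤ D / q + c * (2 * (T ^ l * volume.real S)) / p := by
          have hq := hpq.symm.pos
          refine add_le_add ?_ ?_
          · rw [div_mul_eq_mul_div]
            refine div_le_div_of_nonneg_right ?_ hq.le
            exact (mul_le_mul_of_nonneg_left hXS hk0.le).trans hkX
          · rw [div_mul_eq_mul_div]
            refine div_le_div_of_nonneg_right (mul_le_mul_of_nonneg_left ?_ hc0) hp.le
            rw [integral_add hul (integrable_const _), setIntegral_const, smul_eq_mul]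
            linarith
  -- Absorption of `D / q`, using `1 - 1/q = 1/p`.
  have hDc : D ≤ c * (2 * (T ^ l * volume.real S)) := by
    have h1 := hpq.inv_add_inv_eq_one
    have h2 : D / p ≤ c * (2 * (T ^ l * volume.real S)) / p := by
      have : D / p = D - D / q := by
        rw [div_eq_mul_inv, div_eq_mul_inv]
        linear_combination D * h1
      linarith
    exact (div_le_div_iff_of_pos_right hp).1 h2
  refine hDc.trans (le_of_eq ?_)
  have e1 : (k * α) ^ (-(p - 1)) = (lam / (κ * α)) ^ (p - 1) * T ^ (-(α * (p - 1))) := by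
    have : k * α = (lam / (κ * α))⁻¹ * T ^ α := by rw [hk]; field_simp
    rw [this, Real.mul_rpow (by positivity) (by positivity), Real.inv_rpow (by positivity),
      ← Real.rpow_mul hT.le, Real.rpow_neg (x := lam / (κ * α)) (by positivity), inv_inv,
      mul_neg]
  have e2 : T ^ (p - 1) = T ^ (-(α * (p - 1))) * T ^ l := by
    rw [← Real.rpow_add hT]
    congr 1
    linear_combination hαl
  rw [hc, e1, e2, Real.rpow_add two_pos, Real.rpow_one]
  ring

/-! ### From `D` to the integral of `f`, and the choice of `T`. -/

theorem lintegral_mul_rpow_le {u f : EuclideanSpace ℝ (Fin N) → ℝ}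
    {F G : EuclideanSpace ℝ (Fin N) → EuclideanSpace ℝ (Fin N)} {ξ : 𝓓(Ω, ℝ)}
    {p q l lam σ κ T : ℝ} {M : ℝ≥0∞} (hpq : p.HolderConjugate q) (hl : p - 1 < l) (hlam : p ≤ lam)
    (hw : HasWeakGradient Ω u G) (hG : MemLpLoc Ω (ENNReal.ofReal p) G)
    (hu : ∀ᵐ x ∂volume.restrict Ω, 0 ≤ u x) (hf : ∀ᵐ x ∂volume.restrict Ω, 0 ≤ f x)
    (hfi : MemLpLoc Ω 1 f) (hF : MemLpLoc Ω (ENNReal.ofReal q) F)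
    (htest : ∀ φ H, IsAdmissible Ω φ H →
      ∫ x in (Ω : Set _), f x * φ x ≤ ∫ x in (Ω : Set _), inner ℝ (F x) (H x))
    (hξ : ∀ x, ξ x ∈ Icc (0 : ℝ) 1) (hσ : σ = 1 ∨ σ = -1) (hκ : 0 < κ)
    (hcoer : ∀ᵐ x ∂volume.restrict Ω, κ * ‖F x‖ ^ q ≤ σ * inner ℝ (F x) (G x))
    (hM : ∀ x, ‖∇ ξ x‖ₑ ≤ M) (hMtop : M ≠ ∞) (hT : 0 < T)
    (hulT : ∫⁻ x in tsupport (∇ ξ), ENNReal.ofReal (u x ^ l) ≤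
      ENNReal.ofReal T ^ l * volume (tsupport (∇ ξ))) :
    ∫⁻ x in (Ω : Set _), ENNReal.ofReal (f x * ξ x ^ lam) ≤
      ENNReal.ofReal (lam * ((lam / (κ * (l / (p - 1) - 1))) ^ (p - 1) * 2 ^ (l + 1))) *
        volume (tsupport (∇ ξ)) * M ^ p * ENNReal.ofReal T ^ (p - 1) := by
  have hp1 : 0 < p - 1 := by linarith [hpq.lt]
  have hl0 : 0 < l := hp1.trans hl
  have hlam0 : 0 < lam := hpq.pos.trans_le hlam
  have hα : 0 < l / (p - 1) - 1 := by rw [sub_pos, lt_div_iff₀ hp1]; linarith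
  have hK : IsCompact (tsupport ξ) := ξ.hasCompactSupport
  have hKΩ : tsupport ξ ⊆ (Ω : Set _) := ξ.tsupport_subset
  have hSK : tsupport (∇ ξ) ⊆ tsupport ξ := tsupport_gradient_subset _
  have hS : IsCompact (tsupport (∇ ξ)) := hasCompactSupport_gradient hK
  have hStop : volume (tsupport (∇ ξ)) ≠ ∞ := hS.measure_lt_top.ne
  have : IsFiniteMeasure (volume.restrict (tsupport ξ)) := ⟨by simpa using hK.measure_lt_top⟩
  have huS : ∀ᵐ x ∂volume.restrict (tsupport (∇ ξ)), 0 ≤ u x ^ l := by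
    filter_upwards [ae_restrict_of_ae_restrict_of_subset (hSK.trans hKΩ) hu] with x hx
    positivity
  have hFi : IntegrableOn F (tsupport ξ) :=
    memLp_one_iff_integrable.1 ((hF _ hK hKΩ).mono_exponent
      (ENNReal.one_le_ofReal.2 hpq.symm.lt.le))
  have hFq : IntegrableOn (fun x => ‖F x‖ ^ q) (tsupport ξ) := by
    have := (hF _ hK hKΩ).integrable_norm_rpow (by simpa using hpq.symm.pos)
      ENNReal.ofReal_ne_top
    rwa [ENNReal.toReal_ofReal hpq.symm.nonneg] at this
  have mul : AEStronglyMeasurable (fun x => u x ^ l) (volume.restrict (tsupport (∇ ξ))) :=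
    ((hw.1 _ hS (hSK.trans hKΩ)).aestronglyMeasurable.aemeasurable.pow_const l).aestronglyMeasurable
  have hul : IntegrableOn (fun x => u x ^ l) (tsupport (∇ ξ)) := by
    refine ⟨mul, (hasFiniteIntegral_iff_ofReal huS).2 (hulT.trans_lt ?_)⟩
    exact ENNReal.mul_lt_top (ENNReal.rpow_lt_top_of_nonneg hl0.le ENNReal.ofReal_ne_top)
      hStop.lt_top
  have hulT' : ∫ x in tsupport (∇ ξ), u x ^ l ≤ T ^ l * volume.real (tsupport (∇ ξ)) := by
    rw [integral_eq_lintegral_of_nonneg_ae huS mul]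
    refine ENNReal.toReal_le_of_le_ofReal (by positivity) (hulT.trans_eq ?_)
    rw [ENNReal.ofReal_mul (by positivity), ENNReal.ofReal_rpow_of_pos hT, measureReal_def,
      ENNReal.ofReal_toReal hStop]
  have hM' : ∀ x, ‖∇ ξ x‖ ≤ M.toReal := fun x => by
    rw [← toReal_enorm]
    exact ENNReal.toReal_mono hMtop (hM x)
  have hD := integral_norm_mul_norm_gradient_le hpq hl hlam hw hG hu hf hFi hFq htest hξ hT hσ hκ
    hcoer hM' hul hulT'
  -- The second test, with `g = 1`, leaves only the `∇ξ` term.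
  have h1 := integral_test_le (hpq.lt.le.trans hlam) (fun x => (hξ x).1) hFi htest
    (g := fun _ => 1) (B := 1) (fun _ _ => contDiffAt_const) (fun _ _ => zero_le_one)
    (fun _ _ => le_rfl) (v := fun _ => 0) contDiff_const (fun _ => le_rfl)
  simp only [one_mul, deriv_const, mul_zero, zero_mul, integral_zero, zero_add] at h1
  have hη : Continuous fun x => ξ x ^ lam := ξ.continuous.rpow_const fun x => Or.inr hlam0.le
  have ifK : IntegrableOn (fun x => f x * ξ x ^ lam) (tsupport ξ) :=
    IntegrableOn.mul_continuousOn (memLp_one_iff_integrable.1 (hfi _ hK hKΩ)) hη.continuousOn hK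
  have ifΩ : IntegrableOn (fun x => f x * ξ x ^ lam) Ω := by
    refine ifK.of_forall_sdiff_eq_zero Ω.isOpen.measurableSet fun x hx => ?_
    rw [image_eq_zero_of_notMem_tsupport hx.2, Real.zero_rpow hlam0.ne', mul_zero]
  have hnn : 0 ≤ᵐ[volume.restrict (Ω : Set _)] fun x => f x * ξ x ^ lam := by
    filter_upwards [hf] with x hx
    exact mul_nonneg hx (Real.rpow_nonneg (hξ x).1 _)
  rw [← ofReal_integral_eq_lintegral_ofReal ifΩ hnn]
  refine (ENNReal.ofReal_le_ofReal (h1.trans (mul_le_mul_of_nonneg_left hD hlam0.le))).trans_eq ?_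
  have e : ENNReal.ofReal (volume.real (tsupport (∇ ξ)) * M.toReal ^ p * T ^ (p - 1)) =
      volume (tsupport (∇ ξ)) * M ^ p * ENNReal.ofReal T ^ (p - 1) := by
    rw [ENNReal.ofReal_mul (by positivity), ENNReal.ofReal_mul (by positivity),
      ← ENNReal.ofReal_rpow_of_pos hT, measureReal_def, ENNReal.ofReal_toReal hStop,
      ← ENNReal.ofReal_rpow_of_nonneg ENNReal.toReal_nonneg hpq.nonneg,
      ENNReal.ofReal_toReal hMtop]
  rw [← mul_assoc, ENNReal.ofReal_mul (by positivity), e]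
  ring

/-- The optimal value `T = m ^ (1/l)` may be zero, hence the approach from above along `m ^ (1/l) +
1/(n+1)`. -/
theorem le_mul_rpow_of_forall_le {a b m : ℝ≥0∞} {l r : ℝ} (hl : 0 < l) (hb : b ≠ ∞) (hm : m ≠ ∞) (h : ∀ T : ℝ, 0 < T → m ≤ ENNReal.ofReal T ^ l →
      a ≤ b * ENNReal.ofReal T ^ r) : a ≤ b * m ^ (r / l) := by
  have hmt : m ^ l⁻¹ ≠ ∞ := ENNReal.rpow_ne_top_of_nonneg (by positivity) hm
  have lim : Tendsto (fun n : ℕ => b * ENNReal.ofReal ((m ^ l⁻¹).toReal + 1 / ((n : ℝ) + 1)) ^ r)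
      atTop (𝓝 (b * (m ^ l⁻¹) ^ r)) := by
    refine ENNReal.Tendsto.const_mul ?_ (Or.inr hb)
    refine (ENNReal.continuous_rpow_const.tendsto _).comp ?_
    have := ENNReal.tendsto_ofReal
      ((tendsto_one_div_add_atTop_nhds_zero_nat (𝕜 := ℝ)).const_add (m ^ l⁻¹).toReal)
    rwa [add_zero, ENNReal.ofReal_toReal hmt] at this
  rw [← ENNReal.rpow_mul, inv_mul_eq_div] at lim
  refine ge_of_tendsto' lim fun n => h _ (by positivity) ?_
  calc m = (m ^ l⁻¹) ^ l := by rw [← ENNReal.rpow_mul, inv_mul_cancel₀ hl.ne', ENNReal.rpow_one]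
    _ ≤ _ := by
      refine ENNReal.rpow_le_rpow ?_ hl.le
      rw [← ENNReal.ofReal_toReal hmt]
      refine ENNReal.ofReal_le_ofReal ?_
      rw [ENNReal.toReal_ofReal ENNReal.toReal_nonneg]
      have : 0 < 1 / ((n : ℝ) + 1) := by positivity
      linarith

theorem lintegral_mul_rpow_le_laverage {u f : EuclideanSpace ℝ (Fin N) → ℝ}
    {F G : EuclideanSpace ℝ (Fin N) → EuclideanSpace ℝ (Fin N)} {ξ : 𝓓(Ω, ℝ)}
    {p q l lam σ κ : ℝ} (hpq : p.HolderConjugate q) (hl : p - 1 < l) (hlam : p ≤ lam)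
    (hw : HasWeakGradient Ω u G) (hG : MemLpLoc Ω (ENNReal.ofReal p) G)
    (hu : ∀ᵐ x ∂volume.restrict Ω, 0 ≤ u x) (hf : ∀ᵐ x ∂volume.restrict Ω, 0 ≤ f x)
    (hfi : MemLpLoc Ω 1 f) (hF : MemLpLoc Ω (ENNReal.ofReal q) F)
    (htest : ∀ φ H, IsAdmissible Ω φ H →
      ∫ x in (Ω : Set _), f x * φ x ≤ ∫ x in (Ω : Set _), inner ℝ (F x) (H x))
    (hξ : ∀ x, ξ x ∈ Icc (0 : ℝ) 1) (hσ : σ = 1 ∨ σ = -1) (hκ : 0 < κ)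
    (hcoer : ∀ᵐ x ∂volume.restrict Ω, κ * ‖F x‖ ^ q ≤ σ * inner ℝ (F x) (G x)) :
    ∫⁻ x in (Ω : Set _), ENNReal.ofReal (f x * ξ x ^ lam) ≤
      ENNReal.ofReal (lam * ((lam / (κ * (l / (p - 1) - 1))) ^ (p - 1) * 2 ^ (l + 1))) *
        volume (tsupport (∇ ξ)) * (⨆ x ∈ Ω, ‖∇ ξ x‖ₑ) ^ p *
          (⨍⁻ x in tsupport (∇ ξ), ENNReal.ofReal (u x ^ l) ∂volume) ^ ((p - 1) / l) := by
  have hp1 : 0 < p - 1 := by linarith [hpq.lt]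
  have hl0 : 0 < l := hp1.trans hl
  have hlam0 : 0 < lam := hpq.pos.trans_le hlam
  have hα : 0 < l / (p - 1) - 1 := by rw [sub_pos, lt_div_iff₀ hp1]; linarith
  have hK : IsCompact (tsupport ξ) := ξ.hasCompactSupport
  have hKΩ : tsupport ξ ⊆ (Ω : Set _) := ξ.tsupport_subset
  have hSK : tsupport (∇ ξ) ⊆ tsupport ξ := tsupport_gradient_subset _
  have hS : IsCompact (tsupport (∇ ξ)) := hasCompactSupport_gradient hK
  have hStop : volume (tsupport (∇ ξ)) ≠ ∞ := hS.measure_lt_top.ne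
  set M := ⨆ x ∈ Ω, ‖∇ ξ x‖ₑ
  have hM : ∀ x, ‖∇ ξ x‖ₑ ≤ M := fun x => by
    by_cases hx : x ∈ Ω
    · exact le_iSup₂ (f := fun x (_ : x ∈ Ω) => ‖∇ ξ x‖ₑ) x hx
    · rw [image_eq_zero_of_notMem_tsupport fun h => hx (hKΩ (hSK h)), enorm_zero]
      exact zero_le
  have hMtop : M ≠ ∞ := by
    obtain ⟨C, hC⟩ := (hasCompactSupport_gradient hK).exists_bound_of_continuous
      (continuous_gradient (ξ.contDiff.of_le (by simp)))
    refine ((iSup₂_le fun x _ => ?_).trans_lt (ENNReal.ofReal_lt_top (r := C))).ne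
    rw [← ofReal_norm]
    exact ENNReal.ofReal_le_ofReal (hC x)
  have key := fun T hT => lintegral_mul_rpow_le (M := M) (T := T) hpq hl hlam hw hG hu hf hfi hF
    htest hξ hσ hκ hcoer hM hMtop hT
  -- If `S_ξ` is null the condition on `T` is void, and `T = 1` already gives zero on the right.
  by_cases hS0 : volume (tsupport (∇ ξ)) = 0
  · have := key 1 one_pos (by rw [Measure.restrict_eq_zero.2 hS0]; simp)
    rw [hS0] at this ⊢
    simpa using this
  rw [setLAverage_eq]
  by_cases hm : (∫⁻ x in tsupport (∇ ξ), ENNReal.ofReal (u x ^ l)) / volume (tsupport (∇ ξ)) = ∞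
  · have hM0 : M ≠ 0 := fun h => hS0 <| by
      have : ∇ ξ = 0 := funext fun x => by simpa [h] using hM x
      rw [this]
      simp
    rw [hm, ENNReal.top_rpow_of_pos (by positivity), ENNReal.mul_top]
    · exact le_top
    · refine mul_ne_zero (mul_ne_zero ?_ hS0) (ENNReal.rpow_pos (pos_iff_ne_zero.2 hM0) hMtop).ne'
      rw [ne_eq, ENNReal.ofReal_eq_zero, not_le]
      positivity
  · refine le_mul_rpow_of_forall_le hl0 ?_ hm fun T hT hmT => key T hT ?_
    · exact ENNReal.mul_ne_top (ENNReal.mul_ne_top ENNReal.ofReal_ne_top hStop)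
        (ENNReal.rpow_ne_top_of_nonneg hpq.nonneg hMtop)
    · exact (ENNReal.div_le_iff hS0 hStop).1 hmT

end QuasilinearEstimate

theorem mainTheorem11 (p l : ℝ) (hp : 1 < p) (hl : p - 1 < l) :
    ∃ lam₀ : ℝ, 0 < lam₀ ∧ ∀ lam : ℝ, lam₀ ≤ lam → ∀ (N : ℕ) (K : ℝ), 0 < K →
      ∃ C : ℝ≥0, 0 < C ∧
        ∀ (Ω : Opens (EuclideanSpace ℝ (Fin N)))
          (A : EuclideanSpace ℝ (Fin N) → ℝ → EuclideanSpace ℝ (Fin N) →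
            EuclideanSpace ℝ (Fin N))
          (f u : EuclideanSpace ℝ (Fin N) → ℝ) (ξ : 𝓓(Ω, ℝ)),
          QuasilinearEstimate.IsCaratheodory Ω A →
          QuasilinearEstimate.IsWeaklyCoercive Ω p K A →
          QuasilinearEstimate.MemLpLoc Ω 1 f →
          (∀ᵐ x ∂volume.restrict Ω, 0 ≤ f x) →
          (∀ᵐ x ∂volume.restrict Ω, 0 ≤ u x) →
          (QuasilinearEstimate.IsWeakSupersolution Ω p A f u ∨
            QuasilinearEstimate.IsWeakSubsolution Ω p A (fun x => - f x) u) →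
          (∀ x, ξ x ∈ Icc (0 : ℝ) 1) →
          ∫⁻ x in (Ω : Set _), ENNReal.ofReal (f x * ξ x ^ lam) ≤
            C * volume (tsupport (∇ ξ)) * (⨆ x ∈ Ω, ‖∇ ξ x‖ₑ) ^ p *
              (⨍⁻ x in tsupport (∇ ξ), ENNReal.ofReal (u x ^ l) ∂volume) ^ ((p - 1) / l) := by
  have hpq := Real.HolderConjugate.conjExponent hp
  have hp1 : 0 < p - 1 := by linarith
  have hα : 0 < l / (p - 1) - 1 := by rw [sub_pos, lt_div_iff₀ hp1]; linarith
  -- The threshold `p` suffices for every `l`, and the constant does not depend on `N`.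
  refine ⟨p, hpq.pos, fun lam hlam N K hK =>
    ⟨(lam * ((lam / (K * (l / (p - 1) - 1))) ^ (p - 1) * 2 ^ (l + 1))).toNNReal, ?_, ?_⟩⟩
  · have hlam0 : 0 < lam := hpq.pos.trans_le hlam
    rw [Real.toNNReal_pos]
    positivity
  intro Ω A f u ξ _ hcoer hf hf0 hu hsol hξ
  have hcoer' : ∀ G : EuclideanSpace ℝ (Fin N) → EuclideanSpace ℝ (Fin N),
      ∀ᵐ x ∂volume.restrict (Ω : Set _), K * ‖A x (u x) (G x)‖ ^ p.conjExponent ≤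
        inner ℝ (A x (u x) (G x)) (G x) := fun G => by
    filter_upwards [hu, ae_restrict_mem Ω.isOpen.measurableSet] with x hx hxΩ
    exact hcoer x hxΩ _ hx _
  rcases hsol with ⟨G, ⟨hw, -, hG⟩, hF, htest⟩ | ⟨G, ⟨hw, -, hG⟩, hF, htest⟩
  · exact QuasilinearEstimate.lintegral_mul_rpow_le_laverage hpq hl hlam hw hG hu hf0 hf hF htest
      hξ (Or.inl rfl) hK (by simpa using hcoer' G)
  · refine QuasilinearEstimate.lintegral_mul_rpow_le_laverage (σ := -1)
      (F := fun x => - A x (u x) (G x)) hpq hl hlam hw hG hu hf0 hf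
      (fun S hS hSΩ => (hF S hS hSΩ).neg) (fun φ H h => ?_)
      hξ (Or.inr rfl) hK (by simpa using hcoer' G)
    have := htest φ H h
    simp only [neg_mul, inner_neg_left, integral_neg] at this ⊢
    linarith
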